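/- A variety of monoids is a class of monoids closed under homomorphic images, submonoids and arbitrary direct products; the variety generated by a monoid is the smallest variety containing it, and the join of two varieties is the smallest variety containing both. Let $\mathbf{Comm}$ be the variety of all commutative monoids, and let $\mathbf{B}$ be the variety generated by the bicyclic monoid $\langle p,q \mid pq=1\rangle$. For a word $w$ over the positive integers $\mathbb{N}$, let $P(w)$ be the binary tree obtained by inserting the letters of $w$ one after the other, from right to left, into the empty tree, where a letter $a$ is added as a new leaf, descending from each node labelled $x$ to the left if $a\le x$ and to the right if $a>x$. Let $P_{\#}(w)$ be the binary tree obtained by inserting the letters of $w$ from left to right, descending from each node labelled $x$ to the right if $a\ge x$ and to the left if $a<x$. The relations $P(u)=P(v)$ and $P_{\#}(u)=P_{\#}(v)$ are congruences on the free monoid $\mathbb{N}^*$; the quotients are the (infinite-rank) sylvester monoid $\mathsf{sylv}$ and $\#$-sylvester monoid $\mathsf{sylv}^{\#}$. The same quotients of $\{1,\dots,n\}^*$ are the sylvester monoid $\mathsf{sylv}_n$ and the $\#$-sylvester monoid $\mathsf{sylv}^{\#}_n$ of rank $n$. For a commutative semiring $S$ with $0$ and $1$ and an element $\alpha\in S$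 of infinite multiplicative order (that is, the powers $\alpha^k$, $k\ge 0$, are pairwise distinct), let $\mathcal{M}$ and $\mathcal{M}_{\#}$ be the submonoids of the monoid of upper triangular $2\times 2$ matrices over $S$ generated respectively by $$\begin{bmatrix}1&1\\0&0\end{bmatrix},\ \begin{bmatrix}1&0\\0&\alpha\end{bmatrix}\qquad\text{and}\qquad \begin{bmatrix}\alpha&0\\0&1\end{bmatrix},\ \begin{bmatrix}0&1\\0&1\end{bmatrix}.$$ **Proposition.** Let $n\ge 2$. Then the variety of monoids generated by $\mathsf{sylv}_n$ (respectively, $\mathsf{sylv}^{\#}_n$) is 1. a proper subvariety of $\mathbf{B}$; 2. equal to the variety generated by the monoid $\mathcal{M}$ (respectively, $\mathcal{M}_{\#}$), which is infinite, for every such $S$ and $\alpha$; 3. not contained in the join of $\mathbf{Comm}$ and any variety generated by a finite monoid; 4. equal to the variety generated by the infinite-rank monoid $\mathsf{sylv}$ (respectively, $\mathsf{sylv}^{\#}$). -/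

import Mathlib

universe u v

/-! ### Varieties of monoids -/

/-- A variety of monoids (in the universe `u`): a class of monoids that is closed under
homomorphic images, submonoids and arbitrary (possibly empty, possibly infinite) direct
products. -/
@[ext]
structure MonoidVariety : Type (u + 1) where
  Mem : (M : Type u) → [Monoid M] → Prop
  of_surjective : ∀ (M N : Type u) [Monoid M] [Monoid N] (f : M →* N),
    Function.Surjective f → Mem M → Mem N
  of_submonoid : ∀ (M : Type u) [Monoid M] (H : Submonoid M), Mem M → Mem H
  of_pi : ∀ (ι : Type u) (M : ι → Type u) [∀ i, Monoid (M i)],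
    (∀ i, Mem (M i)) → Mem (∀ i, M i)

namespace MonoidVariety

/-- Varieties are ordered by inclusion: `V ≤ W` means that `V` is a subvariety of `W`. -/
instance : PartialOrder MonoidVariety.{u} where
  le V W := ∀ (M : Type u) [Monoid M], V.Mem M → W.Mem M
  le_refl _ _ _ h := h
  le_trans _ _ _ h₁ h₂ M _ h := h₂ M (h₁ M h)
  le_antisymm V W h₁ h₂ := by
    ext M inst
    exact ⟨h₁ M, h₂ M⟩

/-- The smallest variety containing a given class of monoids. -/
def generate (P : (M : Type u) → [Monoid M] → Prop) : MonoidVariety.{u} where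
  Mem M _ := ∀ V : MonoidVariety.{u}, (∀ (N : Type u) [Monoid N], P N → V.Mem N) → V.Mem M
  of_surjective M N _ _ f hf h V hV := V.of_surjective M N f hf (h V hV)
  of_submonoid M _ H h V hV := V.of_submonoid M H (h V hV)
  of_pi ι M _ h V hV := V.of_pi ι M fun i => h i V hV

/-- The join of two varieties: the smallest variety containing both of them. -/
def join (V W : MonoidVariety.{u}) : MonoidVariety.{u} :=
  generate fun M _ => V.Mem M ∨ W.Mem M

/-- `join` is the least upper bound for inclusion, written `V ⊔ W`. -/
instance : SemilatticeSup MonoidVariety.{u} where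
  sup := join
  le_sup_left _ _ M _ h _ hU := hU M (Or.inl h)
  le_sup_right _ _ M _ h _ hU := hU M (Or.inr h)
  sup_le _ _ U h₁ h₂ _ _ h := h U fun N _ hN => hN.elim (h₁ N) (h₂ N)

/-- The variety generated by one monoid `M`: the smallest variety containing `M`.
The monoid may live in a smaller universe than the members of the variety, in which case the
copy `ULift M` of `M` is used. -/
def generatedBy (M : Type v) [Monoid M] : MonoidVariety.{max u v} where
  Mem N _ := ∀ V : MonoidVariety.{max u v}, V.Mem (ULift.{u} M) → V.Mem N
  of_surjective M N _ _ f hf h V hV := V.of_surjective M N f hf (h V hV)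
  of_submonoid M _ H h V hV := V.of_submonoid M H (h V hV)
  of_pi ι M _ h V hV := V.of_pi ι M fun i => h i V hV

/-- The variety `Comm` of all commutative monoids. -/
def comm : MonoidVariety.{u} where
  Mem M _ := ∀ a b : M, a * b = b * a
  of_surjective _ _ _ _ f hf h a b := by
    obtain ⟨a, rfl⟩ := hf a
    obtain ⟨b, rfl⟩ := hf b
    rw [← map_mul, h, map_mul]
  of_submonoid _ _ _ h a b := Subtype.ext (h a b)
  of_pi _ _ _ h a b := funext fun i => h i (a i) (b i)

end MonoidVariety

/-! ### The bicyclic monoid -/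

/-- The defining relation `p q = 1` of the bicyclic monoid; here `p` is the letter `0` and `q`
is the letter `1`. -/
inductive BicyclicRel : FreeMonoid (Fin 2) → FreeMonoid (Fin 2) → Prop
  | rel : BicyclicRel (FreeMonoid.of 0 * FreeMonoid.of 1) 1

/-- The bicyclic monoid `⟨p, q | p q = 1⟩`. -/
abbrev Bicyclic : Type := PresentedMonoid BicyclicRel

/-- The variety `B` generated by the bicyclic monoid. -/
def MonoidVariety.bicyclic : MonoidVariety.{u} :=
  MonoidVariety.generatedBy.{u, 0} Bicyclic

/-! ### Binary search trees, sylvester and #-sylvester monoids -/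

section Trees

variable {A : Type v} [LinearOrder A]

/-- Right strict leaf insertion `a → T`. -/
def insertRS (a : A) : BinaryTree A → BinaryTree A
  | .nil => .node a .nil .nil
  | .node x l r => if a ≤ x then .node x (insertRS a l) r else .node x l (insertRS a r)

/-- Left strict leaf insertion `T ← a`. -/
def insertLS (a : A) : BinaryTree A → BinaryTree A
  | .nil => .node a .nil .nil
  | .node x l r => if x ≤ a then .node x l (insertLS a r) else .node x (insertLS a l) r

/-- The right strict binary search tree of a word: the letters are inserted one after the other,
from right to left, starting from the empty tree. -/
def sylvTree (w : List A) : BinaryTree A :=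
  w.foldr (fun a T => insertRS a T) .nil

/-- The left strict binary search tree of a word: the letters are inserted one after the other,
from left to right, starting from the empty tree. -/
def sylvSharpTree (w : List A) : BinaryTree A :=
  w.foldl (fun T a => insertLS a T) .nil

/-! #### Auxiliary facts: equality of trees is a congruence -/

/-- Deletes the nodes with labels above `x` from a right strict binary search tree. -/
def cutLE (x : A) : BinaryTree A → BinaryTree A
  | .nil => .nil
  | .node y l r => if y ≤ x then .node y l (cutLE x r) else cutLE x l

/-- Deletes the nodes with labels at most `x` from a right strict binary search tree. -/
def cutGT (x : A) : BinaryTree A → BinaryTree A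
  | .nil => .nil
  | .node y l r => if y ≤ x then cutGT x r else .node y (cutGT x l) r

/-- Deletes the nodes with labels below `x` from a left strict binary search tree. -/
def cutGE (x : A) : BinaryTree A → BinaryTree A
  | .nil => .nil
  | .node y l r => if x ≤ y then .node y (cutGE x l) r else cutGE x r

/-- Deletes the nodes with labels at least `x` from a left strict binary search tree. -/
def cutLT (x : A) : BinaryTree A → BinaryTree A
  | .nil => .nil
  | .node y l r => if x ≤ y then cutLT x l else .node y l (cutLT x r)

theorem cutLE_insertRS (x a : A) (T : BinaryTree A) :
    cutLE x (insertRS a T) = if a ≤ x then insertRS a (cutLE x T) else cutLE x T := by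
  induction T with
  | nil => simp [insertRS, cutLE]
  | node y l r ihl ihr => grind [insertRS, cutLE]

theorem cutGT_insertRS (x a : A) (T : BinaryTree A) :
    cutGT x (insertRS a T) = if a ≤ x then cutGT x T else insertRS a (cutGT x T) := by
  induction T with
  | nil => simp [insertRS, cutGT]
  | node y l r ihl ihr => grind [insertRS, cutGT]

theorem cutGE_insertLS (x a : A) (T : BinaryTree A) :
    cutGE x (insertLS a T) = if x ≤ a then insertLS a (cutGE x T) else cutGE x T := by
  induction T with
  | nil => simp [insertLS, cutGE]
  | node y l r ihl ihr => grind [insertLS, cutGE]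

theorem cutLT_insertLS (x a : A) (T : BinaryTree A) :
    cutLT x (insertLS a T) = if x ≤ a then cutLT x T else insertLS a (cutLT x T) := by
  induction T with
  | nil => simp [insertLS, cutLT]
  | node y l r ihl ihr => grind [insertLS, cutLT]

theorem sylvTree_cons (a : A) (w : List A) : sylvTree (a :: w) = insertRS a (sylvTree w) := rfl

theorem sylvTree_filter_le (x : A) (w : List A) :
    sylvTree (w.filter fun a => a ≤ x) = cutLE x (sylvTree w) := by
  induction w with
  | nil => rfl
  | cons a w ih =>
    rw [sylvTree_cons, cutLE_insertRS, ← ih]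
    by_cases h : a ≤ x <;> simp [h, sylvTree_cons]

theorem sylvTree_filter_gt (x : A) (w : List A) :
    sylvTree (w.filter fun a => ¬ a ≤ x) = cutGT x (sylvTree w) := by
  induction w with
  | nil => rfl
  | cons a w ih =>
    rw [sylvTree_cons, cutGT_insertRS, ← ih]
    by_cases h : a ≤ x <;> simp [h, sylvTree_cons, -not_le]

theorem sylvSharpTree_concat (a : A) (w : List A) :
    sylvSharpTree (w ++ [a]) = insertLS a (sylvSharpTree w) := by
  simp [sylvSharpTree]

theorem sylvSharpTree_filter_ge (x : A) (w : List A) :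
    sylvSharpTree (w.filter fun a => x ≤ a) = cutGE x (sylvSharpTree w) := by
  induction w using List.reverseRecOn with
  | nil => rfl
  | append_singleton w a ih =>
    rw [sylvSharpTree_concat, cutGE_insertLS, ← ih]
    by_cases h : x ≤ a <;> simp [h, sylvSharpTree_concat]

theorem sylvSharpTree_filter_lt (x : A) (w : List A) :
    sylvSharpTree (w.filter fun a => ¬ x ≤ a) = cutLT x (sylvSharpTree w) := by
  induction w using List.reverseRecOn with
  | nil => rfl
  | append_singleton w a ih =>
    rw [sylvSharpTree_concat, cutLT_insertLS, ← ih]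
    by_cases h : x ≤ a
    · simp [h]
    · rw [if_neg h, List.filter_append]
      rw [← sylvSharpTree_concat]
      simp [h, -not_le]

theorem foldr_insertRS_node (w : List A) (x : A) (l r : BinaryTree A) :
    w.foldr (fun a T => insertRS a T) (.node x l r) =
      .node x ((w.filter fun a => a ≤ x).foldr (fun a T => insertRS a T) l)
        ((w.filter fun a => ¬ a ≤ x).foldr (fun a T => insertRS a T) r) := by
  induction w with
  | nil => rfl
  | cons a w ih =>
    rw [List.foldr_cons, ih]
    by_cases h : a ≤ x <;> simp [h, insertRS, -not_le]

theorem foldl_insertLS_node (w : List A) (x : A) (l r : BinaryTree A) :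
    w.foldl (fun T a => insertLS a T) (.node x l r) =
      .node x ((w.filter fun a => ¬ x ≤ a).foldl (fun T a => insertLS a T) l)
        ((w.filter fun a => x ≤ a).foldl (fun T a => insertLS a T) r) := by
  induction w generalizing l r with
  | nil => rfl
  | cons a w ih =>
    rw [List.foldl_cons, insertLS]
    by_cases h : x ≤ a
    · rw [if_pos h, ih]; simp [h]
    · rw [if_neg h, ih]; simp [h, -not_le]

theorem foldr_insertRS_congr (T : BinaryTree A) : ∀ w₁ w₂ : List A, sylvTree w₁ = sylvTree w₂ →
    w₁.foldr (fun a T => insertRS a T) T = w₂.foldr (fun a T => insertRS a T) T := by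
  induction T with
  | nil => exact fun _ _ h => h
  | node x l r ihl ihr =>
    intro w₁ w₂ h
    rw [foldr_insertRS_node, foldr_insertRS_node]
    congr 1
    · exact ihl _ _ (by rw [sylvTree_filter_le, sylvTree_filter_le, h])
    · exact ihr _ _ (by rw [sylvTree_filter_gt, sylvTree_filter_gt, h])

theorem foldl_insertLS_congr (T : BinaryTree A) :
    ∀ w₁ w₂ : List A, sylvSharpTree w₁ = sylvSharpTree w₂ →
    w₁.foldl (fun T a => insertLS a T) T = w₂.foldl (fun T a => insertLS a T) T := by
  induction T with
  | nil => exact fun _ _ h => h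
  | node x l r ihl ihr =>
    intro w₁ w₂ h
    rw [foldl_insertLS_node, foldl_insertLS_node]
    congr 1
    · exact ihl _ _ (by rw [sylvSharpTree_filter_lt, sylvSharpTree_filter_lt, h])
    · exact ihr _ _ (by rw [sylvSharpTree_filter_ge, sylvSharpTree_filter_ge, h])

end Trees

/-- The sylvester congruence on words over a totally ordered alphabet: two words are related if
and only if they have the same right strict binary search tree. -/
def sylvesterCon (A : Type v) [LinearOrder A] : Con (FreeMonoid A) where
  r w₁ w₂ := sylvTree w₁.toList = sylvTree w₂.toList
  iseqv := ⟨fun _ => rfl, Eq.symm, Eq.trans⟩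
  mul' {w₁ w₂ w₃ w₄} h₁ h₂ := by
    change sylvTree w₁.toList = sylvTree w₂.toList at h₁
    change sylvTree w₃.toList = sylvTree w₄.toList at h₂
    rw [FreeMonoid.toList_mul, FreeMonoid.toList_mul, sylvTree, sylvTree, List.foldr_append,
      List.foldr_append]
    rw [sylvTree, sylvTree] at h₂
    rw [h₂]
    exact foldr_insertRS_congr _ _ _ h₁

/-- The #-sylvester congruence on words over a totally ordered alphabet: two words are related if
and only if they have the same left strict binary search tree. -/
def sylvesterSharpCon (A : Type v) [LinearOrder A] : Con (FreeMonoid A) where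
  r w₁ w₂ := sylvSharpTree w₁.toList = sylvSharpTree w₂.toList
  iseqv := ⟨fun _ => rfl, Eq.symm, Eq.trans⟩
  mul' {w₁ w₂ w₃ w₄} h₁ h₂ := by
    change sylvSharpTree w₁.toList = sylvSharpTree w₂.toList at h₁
    change sylvSharpTree w₃.toList = sylvSharpTree w₄.toList at h₂
    rw [FreeMonoid.toList_mul, FreeMonoid.toList_mul, sylvSharpTree, sylvSharpTree,
      List.foldl_append, List.foldl_append]
    rw [sylvSharpTree, sylvSharpTree] at h₁
    rw [h₁]
    exact foldl_insertLS_congr _ _ _ h₂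

/-- The sylvester monoid over the alphabet of all positive integers (infinite rank). -/
abbrev Sylv : Type := (sylvesterCon ℕ+).Quotient

/-- The sylvester monoid of rank `n`. The alphabet `{1 < 2 < ⋯ < n}` is modelled by `Fin n`. -/
abbrev SylvRank (n : ℕ) : Type := (sylvesterCon (Fin n)).Quotient

/-- The #-sylvester monoid over the alphabet of all positive integers (infinite rank). -/
abbrev SylvSharp : Type := (sylvesterSharpCon ℕ+).Quotient

/-- The #-sylvester monoid of rank `n`. The alphabet `{1 < 2 < ⋯ < n}` is modelled by `Fin n`. -/
abbrev SylvSharpRank (n : ℕ) : Type := (sylvesterSharpCon (Fin n)).Quotient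

/-! ### The matrix monoids `M` and `M_#` -/

/-- The monoid generated by the two upper triangular matrices
`I = [[1, 1], [0, 0]]` and `J = [[1, 0], [0, α]]`. -/
def matrixM {S : Type v} [CommSemiring S] (α : S) : Submonoid (Matrix (Fin 2) (Fin 2) S) :=
  Submonoid.closure {!![1, 1; 0, 0], !![1, 0; 0, α]}

/-- The monoid generated by the two upper triangular matrices
`I_# = [[α, 0], [0, 1]]` and `J_# = [[0, 1], [0, 1]]`. -/
def matrixMSharp {S : Type v} [CommSemiring S] (α : S) :
    Submonoid (Matrix (Fin 2) (Fin 2) S) :=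
  Submonoid.closure {!![α, 0; 0, 1], !![0, 1; 0, 1]}

/-! ### Membership in varieties -/

namespace MonoidVariety

/-! All four assertions reduce to one small monoid, `ResetCounter`, called R here. The tree of a
word is determined by, and determines, for all letters y ≤ x, whether a letter of [y, x) occurs and
how often x occurs after the last such letter (`sylvTree_eq_iff`). Each of these data is a
homomorphism to R, and for y < x it is onto. Hence over any alphabet with at least two letters the
sylvester monoid generates the variety of R, whatever the rank. Mirror images of trees give the
opposite of R for the #-sylvester monoid.

The matrix monoids are faithful copies of R and its opposite. R lies in the bicyclic variety because
q ^ N, acting on ℕ as a truncated N-fold predecessor, resets every counter value up to N. The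
inclusion is strict: R satisfies abab ≈ baab, which for a = p, b = q would give qp = 1. A finite
monoid satisfies x ^ i ≈ x ^ j for some i ≠ j, so it satisfies x ^ i y x ^ j ≈ x ^ j y x ^ i, as
does every commutative monoid; R does not. -/

theorem mem_of_mulEquiv (V : MonoidVariety.{u}) {M N : Type u} [Monoid M] [Monoid N]
    (e : M ≃* N) (h : V.Mem M) : V.Mem N :=
  V.of_surjective _ _ e.toMonoidHom e.surjective h

/-- A quotient `N` of `F` lies in every variety containing `Q`, if the kernel of `F → N` contains
the common kernel of a family of homomorphisms `F → Q`. -/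
theorem mem_of_separating (V : MonoidVariety.{u}) {ι : Type} {F : Type v} {Q N : Type u}
    [Monoid F] [Monoid Q] [Monoid N] (hQ : V.Mem Q) (φ : ι → F →* Q) (ψ : F →* N)
    (hψ : Function.Surjective ψ) (h : ∀ a b, (∀ i, φ i a = φ i b) → ψ a = ψ b) : V.Mem N := by
  -- The range of `Φ` is a submonoid of a power of `Q`, and `ψ` factors through it; `key` makes the
  -- factorization independent of the chosen preimages.
  let Φ : F →* (ULift.{u} ι → Q) := MonoidHom.pi fun i => φ i.down
  have key : ∀ a b, Φ a = Φ b → ψ a = ψ b := fun a b hab =>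
    h a b fun i => congrFun hab (ULift.up i)
  have hpre : ∀ x : MonoidHom.mrange Φ, ∃ a, Φ a = x := fun x => x.2
  choose g hg using hpre
  let χ : MonoidHom.mrange Φ →* N :=
    { toFun := fun x => ψ (g x)
      map_one' := by rw [← map_one ψ]; exact key _ _ (by rw [hg, map_one]; rfl)
      map_mul' := fun x y => by
        rw [← map_mul ψ]; exact key _ _ (by rw [hg, map_mul, hg, hg]; rfl) }
  refine V.of_surjective _ _ χ (fun y => ?_) (V.of_submonoid _ (MonoidHom.mrange Φ)
    (V.of_pi _ _ fun _ => hQ))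
  obtain ⟨a, rfl⟩ := hψ y
  exact ⟨⟨Φ a, a, rfl⟩, key _ _ (hg _)⟩

theorem mem_ulift_of_separating (V : MonoidVariety.{u}) {ι : Type} {F : Type v} {Q N : Type}
    [Monoid F] [Monoid Q] [Monoid N] (hQ : V.Mem (ULift.{u} Q)) (φ : ι → F →* Q) (ψ : F →* N)
    (hψ : Function.Surjective ψ) (h : ∀ a b, (∀ i, φ i a = φ i b) → ψ a = ψ b) :
    V.Mem (ULift.{u} N) := by
  refine V.mem_of_separating hQ
    (fun i => (MulEquiv.ulift.symm : Q ≃* ULift.{u} Q).toMonoidHom.comp (φ i))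
    ((MulEquiv.ulift.symm : N ≃* ULift.{u} N).toMonoidHom.comp ψ)
    ((MulEquiv.ulift.symm : N ≃* ULift.{u} N).surjective.comp hψ) fun a b hab => ?_
  exact congrArg ULift.up (h a b fun i => congrArg ULift.down (hab i))

theorem mem_generatedBy (M : Type) [Monoid M] :
    (generatedBy.{u, 0} M).Mem (ULift.{u} M) := fun _ h => h

theorem generatedBy_le {M : Type} [Monoid M] {V : MonoidVariety.{u}}
    (h : V.Mem (ULift.{u} M)) : generatedBy.{u, 0} M ≤ V := fun _ _ hN => hN V h

theorem generatedBy_eq_of_mulEquiv {M : Type} {N : Type u} [Monoid M] [Monoid N] (e : M ≃* N) :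
    generatedBy.{u, 0} M = generatedBy.{u, u} N := by
  have e' : ULift.{u} M ≃* ULift.{u} N := (MulEquiv.ulift.trans e).trans MulEquiv.ulift.symm
  exact le_antisymm
    (fun _ _ h V hV => h V (V.mem_of_mulEquiv e'.symm hV))
    (fun _ _ h V hV => h V (V.mem_of_mulEquiv e' hV))

/-- The variety of all monoids satisfying the identity `w₁ ≈ w₂`. -/
def ofIdentity {X : Type} (w₁ w₂ : FreeMonoid X) : MonoidVariety.{u} where
  Mem M _ := ∀ f : X → M, FreeMonoid.lift f w₁ = FreeMonoid.lift f w₂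
  of_surjective M N _ _ f hf h g := by
    choose s hs using hf
    have hg : FreeMonoid.lift g = f.comp (FreeMonoid.lift (s ∘ g)) :=
      FreeMonoid.hom_eq fun x => by simp [hs]
    rw [hg, MonoidHom.comp_apply, MonoidHom.comp_apply, h]
  of_submonoid M _ H h g := by
    have hg : H.subtype.comp (FreeMonoid.lift g) = FreeMonoid.lift fun x => (g x : M) :=
      FreeMonoid.hom_eq fun x => by simp
    apply H.subtype_injective
    rw [← MonoidHom.comp_apply, ← MonoidHom.comp_apply, hg, h]
  of_pi ι M _ h g := by
    funext i
    have hg : (Pi.evalMonoidHom M i).comp (FreeMonoid.lift g) = FreeMonoid.lift fun x => g x i :=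
      FreeMonoid.hom_eq fun x => by simp
    have := h i fun x => g x i
    rwa [← hg] at this

end MonoidVariety

/-! ### The reset counter monoid -/

/-- The monoid `⟨I, J | J I = I, I I = I⟩`: the element `J ^ k` adds `k` to a counter, the element
`I J ^ k` sets it to `k`. -/
@[ext]
structure ResetCounter : Type where
  reset : Bool
  count : ℕ

namespace ResetCounter

instance : Monoid ResetCounter where
  one := ⟨false, 0⟩
  mul a b := ⟨a.reset || b.reset, bif b.reset then b.count else a.count + b.count⟩
  one_mul a := by
    rcases a with ⟨_ | _, k⟩
    · exact congrArg _ (Nat.zero_add k)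
    · rfl
  mul_one a := by
    rcases a with ⟨_ | _, k⟩ <;> rfl
  mul_assoc a b c := by
    rcases a with ⟨_ | _, k⟩ <;> rcases b with ⟨_ | _, l⟩ <;> rcases c with ⟨_ | _, m⟩ <;>
      first
        | rfl
        | exact congrArg _ (Nat.add_assoc k l m)

theorem one_def : (1 : ResetCounter) = ⟨false, 0⟩ := rfl

theorem mul_def (a b : ResetCounter) :
    a * b = ⟨a.reset || b.reset, bif b.reset then b.count else a.count + b.count⟩ := rfl

/-- The generator that sets the counter to zero. -/
def clear : ResetCounter := ⟨true, 0⟩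

/-- The generator that adds one to the counter. -/
def tick : ResetCounter := ⟨false, 1⟩

theorem mul_clear (a : ResetCounter) : a * clear = clear := by simp [mul_def, clear]

theorem tick_pow (k : ℕ) : tick ^ k = ⟨false, k⟩ := by
  induction k with
  | zero => rfl
  | succ k ih => rw [pow_succ, ih]; rfl

theorem clear_mul_tick_pow (k : ℕ) : clear * tick ^ k = ⟨true, k⟩ := by
  simp [tick_pow, mul_def, clear]

theorem mul_tick_right_cancel {a b : ResetCounter} (h : a * tick = b * tick) : a = b := by
  simpa [mul_def, tick, ResetCounter.ext_iff] using h

theorem mul_tick_ne_one (a : ResetCounter) : a * tick ≠ 1 := by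
  simp [mul_def, tick, one_def]

theorem mul_tick_ne_clear (a : ResetCounter) : a * tick ≠ clear := by
  simp [mul_def, tick, clear]

theorem closure_clear_tick : Submonoid.closure {clear, tick} = ⊤ := by
  refine top_unique fun a _ => ?_
  have hc : clear ∈ Submonoid.closure {clear, tick} := Submonoid.subset_closure (by simp)
  have ht : tick ∈ Submonoid.closure {clear, tick} := Submonoid.subset_closure (by simp)
  rcases a with ⟨_ | _, k⟩
  · rw [← tick_pow]; exact pow_mem ht k
  · rw [← clear_mul_tick_pow]; exact mul_mem hc (pow_mem ht k)

instance : Infinite ResetCounter :=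
  Infinite.of_injective (fun k => (⟨false, k⟩ : ResetCounter)) fun _ _ h => by simpa using h

/-- The action of the reset counter monoid on the values of the counter. -/
def act (x : ℕ) (a : ResetCounter) : ℕ := bif a.reset then a.count else x + a.count

theorem act_mul (x : ℕ) (a b : ResetCounter) : act x (a * b) = act (act x a) b := by
  rcases a with ⟨_ | _, k⟩ <;> rcases b with ⟨_ | _, l⟩ <;> simp [act, mul_def, add_assoc]

/-- Two starting values are needed: from 0 alone, adding k and setting to k look the same. -/
theorem eq_of_act_eq {a b : ResetCounter} (h₀ : act 0 a = act 0 b) (h₁ : act 1 a = act 1 b) :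
    a = b := by
  rcases a with ⟨_ | _, k⟩ <;> rcases b with ⟨_ | _, l⟩ <;> simp [act] at h₀ h₁ ⊢ <;> omega

/-- The letters of the two-letter alphabet as generators of the reset counter monoid. -/
def gen : Bool → ResetCounter
  | false => tick
  | true => clear

theorem lift_surjective {X : Type v} {f : X → ResetCounter} {x y : X} (hx : f x = clear)
    (hy : f y = tick) : Function.Surjective (FreeMonoid.lift f) := by
  rintro ⟨_ | _, k⟩
  · exact ⟨FreeMonoid.of y ^ k, by simp [hy, tick_pow]⟩
  · exact ⟨FreeMonoid.of x * FreeMonoid.of y ^ k, by simp [hx, hy, clear_mul_tick_pow]⟩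

end ResetCounter

open ResetCounter

/-! ### The matrix monoids are copies of the reset counter monoid -/

section Matrices

variable {S : Type v} [CommSemiring S] (α : S)

/-- If some power vanished, the next power would equal it. -/
theorem pow_ne_zero_of_injective_pow {α : S} (hα : Function.Injective fun k : ℕ => α ^ k)
    (k : ℕ) : α ^ k ≠ 0 := fun h => by
  have : k + 1 = k := hα (by simp [pow_succ, h])
  omega

/-- The representation of the reset counter monoid by the matrices of `matrixM α`. -/
def counterToMatrix : ResetCounter →* Matrix (Fin 2) (Fin 2) S where
  toFun a := bif a.reset then !![1, α ^ a.count; 0, 0] else !![1, 0; 0, α ^ a.count]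
  map_one' := by simp [one_def, Matrix.one_fin_two]
  map_mul' a b := by
    rcases a with ⟨_ | _, k⟩ <;> rcases b with ⟨_ | _, l⟩ <;>
      simp [mul_def, pow_add]

/-- The lower right entry is zero exactly for resets; the count is read there for additions and in
the upper right entry for resets. -/
theorem counterToMatrix_injective (hα : Function.Injective fun k : ℕ => α ^ k) :
    Function.Injective (counterToMatrix α) := by
  have h0 := pow_ne_zero_of_injective_pow hα
  rintro ⟨_ | _, k⟩ ⟨_ | _, l⟩ h
  · have := congrFun (congrFun h 1) 1
    simpa [counterToMatrix] using hα (by simpa [counterToMatrix] using this)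
  · have := congrFun (congrFun h 1) 1
    exact absurd (by simpa [counterToMatrix] using this) (h0 k)
  · have := congrFun (congrFun h 1) 1
    exact absurd (by simpa [counterToMatrix] using this.symm) (h0 l)
  · have := congrFun (congrFun h 0) 1
    simpa [counterToMatrix] using hα (by simpa [counterToMatrix] using this)

theorem mrange_counterToMatrix : MonoidHom.mrange (counterToMatrix α) = matrixM α := by
  rw [MonoidHom.mrange_eq_map, ← closure_clear_tick, MonoidHom.map_mclosure, Set.image_pair]
  simp [counterToMatrix, clear, tick, matrixM]

/-- The representation of the opposite of the reset counter monoid by the matrices of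
`matrixMSharp α`. -/
def counterOpToMatrix : ResetCounterᵐᵒᵖ →* Matrix (Fin 2) (Fin 2) S where
  toFun a := bif a.unop.reset then !![0, α ^ a.unop.count; 0, 1]
    else !![α ^ a.unop.count, 0; 0, 1]
  map_one' := by simp [one_def, Matrix.one_fin_two]
  map_mul' a b := by
    induction a with | _ a
    induction b with | _ b
    rcases a with ⟨_ | _, k⟩ <;> rcases b with ⟨_ | _, l⟩ <;>
      simp [mul_def, pow_add, mul_comm]

theorem counterOpToMatrix_injective (hα : Function.Injective fun k : ℕ => α ^ k) :
    Function.Injective (counterOpToMatrix α) := by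
  have h0 := pow_ne_zero_of_injective_pow hα
  intro a b h
  induction a with | _ a
  induction b with | _ b
  rw [MulOpposite.op_inj]
  rcases a with ⟨_ | _, k⟩ <;> rcases b with ⟨_ | _, l⟩
  · have := congrFun (congrFun h 0) 0
    simpa [counterOpToMatrix] using hα (by simpa [counterOpToMatrix] using this)
  · have := congrFun (congrFun h 0) 0
    exact absurd (by simpa [counterOpToMatrix] using this) (h0 k)
  · have := congrFun (congrFun h 0) 0
    exact absurd (by simpa [counterOpToMatrix] using this.symm) (h0 l)
  · have := congrFun (congrFun h 0) 1
    simpa [counterOpToMatrix] using hα (by simpa [counterOpToMatrix] using this)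

theorem mrange_counterOpToMatrix :
    MonoidHom.mrange (counterOpToMatrix α) = matrixMSharp α := by
  have h : Submonoid.closure {MulOpposite.op tick, MulOpposite.op clear} = ⊤ := by
    refine top_unique fun a _ => ?_
    induction a with | _ a
    have hc : MulOpposite.op clear ∈
        Submonoid.closure {MulOpposite.op tick, MulOpposite.op clear} :=
      Submonoid.subset_closure (by simp)
    have ht : MulOpposite.op tick ∈
        Submonoid.closure {MulOpposite.op tick, MulOpposite.op clear} :=
      Submonoid.subset_closure (by simp)
    rcases a with ⟨_ | _, k⟩
    · rw [← tick_pow, MulOpposite.op_pow]; exact pow_mem ht k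
    · rw [← clear_mul_tick_pow, MulOpposite.op_mul, MulOpposite.op_pow]
      exact mul_mem (pow_mem ht k) hc
  rw [MonoidHom.mrange_eq_map, ← h, MonoidHom.map_mclosure, Set.image_pair]
  simp [counterOpToMatrix, clear, tick, matrixMSharp]

/-- An injective homomorphism is an isomorphism onto any submonoid equal to its range. -/
noncomputable def MonoidHom.equivOfMrangeEq {M N : Type*} [Monoid M] [Monoid N] (f : M →* N)
    (hf : Function.Injective f) {H : Submonoid N} (h : MonoidHom.mrange f = H) : M ≃* H :=
  MulEquiv.ofBijective (f.codRestrict H fun x => h ▸ ⟨x, rfl⟩)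
    ⟨fun _ _ hab => hf (congrArg Subtype.val hab), fun ⟨y, hy⟩ => by
      obtain ⟨x, rfl⟩ := h.symm ▸ hy
      exact ⟨x, rfl⟩⟩

end Matrices

/-! ### Reset counters in the variety of the bicyclic monoid -/

theorem unop_lift_op {X M : Type*} [Monoid M] (f : X → M) (w : FreeMonoid X) :
    (FreeMonoid.lift (fun a => MulOpposite.op (f a)) w).unop = FreeMonoid.lift f w.reverse := by
  induction w using FreeMonoid.recOn with
  | one => rfl
  | of_mul a w ih =>
    simp only [map_mul, MulOpposite.unop_mul, FreeMonoid.lift_eval_of, ih,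
      FreeMonoid.reverse_mul, FreeMonoid.reverse_of, MulOpposite.unop_op]

/-- If `p` and `q` act on the right of `ℕ` as successor and predecessor, then the substitutions
`J ↦ p`, `I ↦ q ^ N` together separate the elements of the reset counter monoid. -/
theorem resetCounter_eq_of_forall_lift_eq {Q : Type*} [Monoid Q] {p q : Q}
    (θ : Q →* (Function.End ℕ)ᵐᵒᵖ) (hp : θ p = MulOpposite.op Nat.succ)
    (hq : θ q = MulOpposite.op Nat.pred) (w₁ w₂ : FreeMonoid Bool)
    (h : ∀ N : ℕ, FreeMonoid.lift (fun b => bif b then q ^ N else p) w₁ =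
      FreeMonoid.lift (fun b => bif b then q ^ N else p) w₂) :
    FreeMonoid.lift gen w₁ = FreeMonoid.lift gen w₂ := by
  have hqN : ∀ N x : ℕ, (θ (q ^ N)).unop x = x - N := by
    intro N
    induction N with
    | zero => intro x; rw [pow_zero, map_one]; rfl
    | succ N ih =>
      intro x
      rw [pow_succ', map_mul, MulOpposite.unop_mul]
      change (θ (q ^ N)).unop ((θ q).unop x) = _
      rw [ih, hq]
      change x.pred - N = _
      rw [Nat.pred_eq_sub_one]
      omega
  -- The bound keeps the counter at most `N` throughout, so truncated subtraction of `N` is a true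
  -- reset. It passes to the rest of the word from `x + 1` after a tick and from `0` after a reset.
  have key : ∀ (N : ℕ) (w : FreeMonoid Bool) (x : ℕ), x + w.length ≤ N →
      (θ (FreeMonoid.lift (fun b => bif b then q ^ N else p) w)).unop x =
        act x (FreeMonoid.lift gen w) := by
    intro N w
    induction w using FreeMonoid.recOn with
    | one => intro x _; rw [map_one, map_one, map_one]; rfl
    | of_mul a w ih =>
      intro x hx
      rw [FreeMonoid.length_mul, FreeMonoid.length_of] at hx
      rw [map_mul, map_mul, map_mul, MulOpposite.unop_mul, act_mul, FreeMonoid.lift_eval_of,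
        FreeMonoid.lift_eval_of]
      cases a with
      | false =>
        change (θ (FreeMonoid.lift _ w)).unop ((θ p).unop x) = _
        rw [hp]
        exact ih (x + 1) (by omega)
      | true =>
        change (θ (FreeMonoid.lift _ w)).unop ((θ (q ^ N)).unop x) = _
        rw [hqN, Nat.sub_eq_zero_of_le (by omega)]
        exact ih 0 (by omega)
  have hact : ∀ x, act x (FreeMonoid.lift gen w₁) = act x (FreeMonoid.lift gen w₂) := fun x => by
    rw [← key (x + w₁.length + w₂.length) w₁ x (by omega),
      ← key (x + w₁.length + w₂.length) w₂ x (by omega), h]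
  exact eq_of_act_eq (hact 0) (hact 1)

/-- The homomorphism from the bicyclic monoid determined by `a` and `b` with `a b = 1`. -/
def bicyclicLift {M : Type*} [Monoid M] (a b : M) (h : a * b = 1) : Bicyclic →* M :=
  PresentedMonoid.lift (rels := BicyclicRel) ![a, b] (by
    rintro _ _ ⟨⟩
    simpa using h)

theorem bicyclicLift_of_zero {M : Type*} [Monoid M] (a b : M) (h : a * b = 1) :
    bicyclicLift a b h (PresentedMonoid.of BicyclicRel 0) = a := rfl

theorem bicyclicLift_of_one {M : Type*} [Monoid M] (a b : M) (h : a * b = 1) :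
    bicyclicLift a b h (PresentedMonoid.of BicyclicRel 1) = b := rfl

/-- The right action of the bicyclic monoid on `ℕ`. -/
def bicyclicRightAction : Bicyclic →* (Function.End ℕ)ᵐᵒᵖ :=
  bicyclicLift (MulOpposite.op Nat.succ) (MulOpposite.op Nat.pred) rfl

/-- The left action of the bicyclic monoid on `ℕ`, as a right action of its opposite. -/
def bicyclicLeftAction : Bicyclicᵐᵒᵖ →* (Function.End ℕ)ᵐᵒᵖ :=
  MonoidHom.op (bicyclicLift (M := Function.End ℕ) Nat.pred Nat.succ rfl)

theorem gen_lift_surjective : Function.Surjective (FreeMonoid.lift gen) :=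
  lift_surjective (x := true) (y := false) rfl rfl

theorem bicyclic_mem_resetCounter :
    MonoidVariety.bicyclic.{u}.Mem (ULift.{u} ResetCounter) :=
  MonoidVariety.mem_ulift_of_separating _ (MonoidVariety.mem_generatedBy Bicyclic) _ _
    gen_lift_surjective
    (resetCounter_eq_of_forall_lift_eq (p := PresentedMonoid.of BicyclicRel 0)
      (q := PresentedMonoid.of BicyclicRel 1) bicyclicRightAction
      (bicyclicLift_of_zero _ _ _) (bicyclicLift_of_one _ _ _))

/-- In the left action on ℕ, q is the successor and p the predecessor, so the same argument runs in
the opposite monoid with p and q exchanged. -/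
theorem bicyclic_mem_resetCounter_op :
    MonoidVariety.bicyclic.{u}.Mem (ULift.{u} ResetCounterᵐᵒᵖ) := by
  refine MonoidVariety.mem_ulift_of_separating _ (MonoidVariety.mem_generatedBy Bicyclic)
    (fun N : ℕ => (MulEquiv.opOp Bicyclic).symm.toMonoidHom.comp (MonoidHom.op (FreeMonoid.lift
      fun b => bif b then MulOpposite.op (PresentedMonoid.of BicyclicRel 0) ^ N
        else MulOpposite.op (PresentedMonoid.of BicyclicRel 1))))
    (MonoidHom.op (FreeMonoid.lift gen)) (fun a => ?_) fun a b h => ?_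
  · obtain ⟨w, hw⟩ := gen_lift_surjective a.unop
    exact ⟨MulOpposite.op w, congrArg MulOpposite.op hw⟩
  · exact congrArg MulOpposite.op (resetCounter_eq_of_forall_lift_eq
      (p := MulOpposite.op (PresentedMonoid.of BicyclicRel 1))
      (q := MulOpposite.op (PresentedMonoid.of BicyclicRel 0)) bicyclicLeftAction
      (congrArg MulOpposite.op (bicyclicLift_of_one _ _ _))
      (congrArg MulOpposite.op (bicyclicLift_of_zero _ _ _)) a.unop b.unop
      fun N => MulOpposite.op_injective ((MulEquiv.opOp Bicyclic).symm.injective (h N)))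

/-! ### Identities separating the varieties -/

/-- In the right action qp sends 0 to 1, since the predecessor is truncated at 0. -/
theorem bicyclic_qp_ne_one :
    PresentedMonoid.of BicyclicRel 1 * PresentedMonoid.of BicyclicRel 0 ≠ 1 := fun h => by
  have h' := congrArg bicyclicRightAction h
  rw [map_mul, map_one, bicyclicRightAction, bicyclicLift_of_one, bicyclicLift_of_zero] at h'
  exact Nat.one_ne_zero (congrFun (congrArg MulOpposite.unop h') 0)

theorem bicyclic_pq_eq_one :
    PresentedMonoid.of BicyclicRel 0 * PresentedMonoid.of BicyclicRel 1 = 1 :=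
  (Con.eq _).2 (ConGen.Rel.of _ _ BicyclicRel.rel)

/-- The monoids satisfying an identity form a variety, so an identity of `M` passes to everything
`M` generates; one failure at the generators p, q refutes the inclusion. -/
theorem not_bicyclic_le_generatedBy {M : Type} [Monoid M] {w₁ w₂ : FreeMonoid (Fin 2)}
    (hM : ∀ f : Fin 2 → M, FreeMonoid.lift f w₁ = FreeMonoid.lift f w₂)
    (hB : FreeMonoid.lift (PresentedMonoid.of BicyclicRel) w₁ ≠
      FreeMonoid.lift (PresentedMonoid.of BicyclicRel) w₂) :
    ¬ MonoidVariety.bicyclic.{u} ≤ MonoidVariety.generatedBy.{u, 0} M := by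
  intro hle
  have hmem := hle _ (MonoidVariety.mem_generatedBy Bicyclic) (MonoidVariety.ofIdentity w₁ w₂)
    fun f => by
      have e : (MulEquiv.ulift : ULift.{u} M ≃* M).toMonoidHom.comp (FreeMonoid.lift f) =
          FreeMonoid.lift fun x => (f x).down := FreeMonoid.hom_eq fun x => by
            simp only [MonoidHom.comp_apply, FreeMonoid.lift_eval_of]; rfl
      apply (MulEquiv.ulift : ULift.{u} M ≃* M).injective
      have := hM fun x => (f x).down
      rwa [← e] at this
  have h := hmem fun x => ULift.up (PresentedMonoid.of BicyclicRel x)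
  have e : (MulEquiv.ulift : ULift.{u} Bicyclic ≃* Bicyclic).toMonoidHom.comp
      (FreeMonoid.lift fun x => ULift.up (PresentedMonoid.of BicyclicRel x)) =
        FreeMonoid.lift (PresentedMonoid.of BicyclicRel) := FreeMonoid.hom_eq fun x => by
          simp only [MonoidHom.comp_apply, FreeMonoid.lift_eval_of]; rfl
  apply hB
  rw [← e]
  exact congrArg ULift.down h

/-- If a or b resets, the final factor ab erases what precedes it; otherwise both are additions and
commute. -/
theorem resetCounter_mul_identity (a b : ResetCounter) : a * b * (a * b) = b * a * (a * b) := by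
  rcases a with ⟨_ | _, k⟩ <;> rcases b with ⟨_ | _, l⟩ <;> (simp [mul_def]; try omega)

theorem resetCounter_lt_bicyclic :
    MonoidVariety.generatedBy.{u, 0} ResetCounter < MonoidVariety.bicyclic.{u} := by
  refine lt_of_le_not_ge (MonoidVariety.generatedBy_le bicyclic_mem_resetCounter)
    (not_bicyclic_le_generatedBy
      (w₁ := FreeMonoid.of 0 * FreeMonoid.of 1 * (FreeMonoid.of 0 * FreeMonoid.of 1))
      (w₂ := FreeMonoid.of 1 * FreeMonoid.of 0 * (FreeMonoid.of 0 * FreeMonoid.of 1))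
      (fun f => ?_) ?_)
  · simpa using resetCounter_mul_identity (f 0) (f 1)
  · simp only [map_mul, FreeMonoid.lift_eval_of, bicyclic_pq_eq_one, mul_one]
    exact bicyclic_qp_ne_one.symm

theorem resetCounter_op_lt_bicyclic :
    MonoidVariety.generatedBy.{u, 0} ResetCounterᵐᵒᵖ < MonoidVariety.bicyclic.{u} := by
  refine lt_of_le_not_ge (MonoidVariety.generatedBy_le bicyclic_mem_resetCounter_op)
    (not_bicyclic_le_generatedBy
      (w₁ := FreeMonoid.of 0 * FreeMonoid.of 1 * (FreeMonoid.of 0 * FreeMonoid.of 1))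
      (w₂ := FreeMonoid.of 0 * FreeMonoid.of 1 * (FreeMonoid.of 1 * FreeMonoid.of 0))
      (fun f => ?_) ?_)
  · apply MulOpposite.unop_injective
    simpa [mul_assoc] using resetCounter_mul_identity (f 1).unop (f 0).unop
  · simp only [map_mul, FreeMonoid.lift_eval_of, bicyclic_pq_eq_one, one_mul]
    exact bicyclic_qp_ne_one.symm

/-- Pigeonhole is applied to the power maps as elements of the finite set of functions F → F, so one
pair of exponents serves all x. -/
theorem exists_pow_eq_pow_of_finite (F : Type*) [Monoid F] [Finite F] :
    ∃ i j : ℕ, i ≠ j ∧ ∀ x : F, x ^ i = x ^ j := by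
  obtain ⟨i, j, hij, h⟩ :=
    Finite.exists_ne_map_eq_of_infinite fun (k : ℕ) (x : F) => x ^ k
  exact ⟨i, j, hij, congrFun h⟩

theorem not_generatedBy_le_comm_sup_finite {M : Type} [Monoid M] {x y : M}
    (hM : ∀ i j : ℕ, x ^ i * y * x ^ j = x ^ j * y * x ^ i → i = j)
    (F : Type u) [Monoid F] [Finite F] :
    ¬ MonoidVariety.generatedBy.{u, 0} M ≤
      MonoidVariety.comm.{u} ⊔ MonoidVariety.generatedBy.{u, u} F := by
  intro hle
  obtain ⟨i, j, hij, hF⟩ := exists_pow_eq_pow_of_finite F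
  let X : FreeMonoid (Fin 2) := FreeMonoid.of 0
  let Y : FreeMonoid (Fin 2) := FreeMonoid.of 1
  let V : MonoidVariety.{u} :=
    MonoidVariety.ofIdentity (X ^ i * Y * X ^ j) (X ^ j * Y * X ^ i)
  have hcomm : MonoidVariety.comm.{u} ≤ V := fun N _ hN f => by
    have hc : ∀ a b : N, Commute a b := hN
    simp only [map_mul]
    rw [mul_assoc, hc _ (_ * _), mul_assoc, mul_assoc, hc (FreeMonoid.lift f Y) (_ * _), mul_assoc,
      hc (FreeMonoid.lift f (X ^ i)) _]
  have hfin : MonoidVariety.generatedBy.{u, u} F ≤ V := fun N _ hN => hN V fun f => by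
    have hU : ∀ z : ULift.{u} F, z ^ i = z ^ j := fun z => congrArg ULift.up (hF z.down)
    simp only [map_mul, map_pow, hU]
  have hmem := (hle.trans (sup_le hcomm hfin)) _ (MonoidVariety.mem_generatedBy M)
    ![ULift.up x, ULift.up y]
  simp only [X, Y, map_mul, map_pow, FreeMonoid.lift_eval_of, Matrix.cons_val_zero,
    Matrix.cons_val_one] at hmem
  exact hij (hM i j (congrArg ULift.down hmem))

/-- The reset erases the left power, so only the right exponent survives. -/
theorem resetCounter_pow_identity {i j : ℕ}
    (h : tick ^ i * clear * tick ^ j = tick ^ j * clear * tick ^ i) : i = j := by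
  rw [mul_clear, mul_clear, clear_mul_tick_pow, clear_mul_tick_pow] at h
  exact (congrArg count h).symm

/-! ### Sylvester monoids as subdirect powers of the reset counter monoid -/

/-- The mirror image of a binary tree, with labels in the dual order. -/
def mirrorDual {A : Type v} : BinaryTree A → BinaryTree Aᵒᵈ
  | .nil => .nil
  | .node z l r => .node (OrderDual.toDual z) (mirrorDual r) (mirrorDual l)

theorem mirrorDual_injective {A : Type v} : Function.Injective (mirrorDual : BinaryTree A → _) := by
  intro T
  induction T with
  | nil => intro T' h; cases T' <;> simp_all [mirrorDual]
  | node z l r ihl ihr =>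
    intro T' h
    cases T' with
    | nil => simp [mirrorDual] at h
    | node z' l' r' =>
      simp only [mirrorDual, BinaryTree.node.injEq] at h
      rw [OrderDual.toDual.injective h.1, ihr h.2.1, ihl h.2.2]

section SylvesterTrees

variable {A : Type v} [LinearOrder A]

/-- The substitution that counts the letters `x` after the last letter in the interval
`[y, x)`. -/
def intervalCounter (y x a : A) : ResetCounter :=
  if a = x then tick else if y ≤ a ∧ a < x then clear else 1

/-- The value under `intervalCounter y x` of the words with a given search tree. -/
def treeCounter (y x : A) : BinaryTree A → ResetCounter
  | .nil => 1
  | .node z l r =>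
    if z < y then treeCounter y x r
    else if z < x then clear else treeCounter y x l * intervalCounter y x z

/-- The root stands for the last letter of the word. A root in [y, x) absorbs all earlier letters by
`mul_clear`. For a root outside [y, x), a letter descending into the subtree that `treeCounter`
ignores is below y or above x, hence is sent to 1. -/
theorem treeCounter_insertRS {y x : A} (hyx : y ≤ x) (a : A) (T : BinaryTree A) :
    treeCounter y x (insertRS a T) = intervalCounter y x a * treeCounter y x T := by
  induction T with
  | nil => grind [treeCounter, insertRS, intervalCounter, one_mul, mul_one]
  | node z l r ihl ihr =>
    by_cases haz : a ≤ z
    · rw [insertRS, if_pos haz, treeCounter, treeCounter, ihl, mul_assoc]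
      split_ifs with h1 h2
      · grind [intervalCounter, one_mul]
      · rw [mul_clear]
      · rfl
    · rw [insertRS, if_neg haz, treeCounter, treeCounter, ihr]
      split_ifs with h1 h2
      · rfl
      · rw [mul_clear]
      · grind [intervalCounter, one_mul]

theorem treeCounter_sylvTree {y x : A} (hyx : y ≤ x) (w : FreeMonoid A) :
    treeCounter y x (sylvTree w.toList) = FreeMonoid.lift (intervalCounter y x) w := by
  induction w using FreeMonoid.recOn with
  | one => rfl
  | of_mul a w ih =>
    rw [MonoidHom.map_mul, FreeMonoid.lift_eval_of, ← ih]
    exact treeCounter_insertRS hyx a _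

/-- Right strict binary search trees with labels in `s`. -/
def IsSearchTree : Set A → BinaryTree A → Prop
  | _, .nil => True
  | s, .node z l r => z ∈ s ∧ IsSearchTree (s ∩ Set.Iic z) l ∧ IsSearchTree (s ∩ Set.Ioi z) r

theorem IsSearchTree.insertRS {s : Set A} {T : BinaryTree A} (hT : IsSearchTree s T) {a : A}
    (ha : a ∈ s) : IsSearchTree s (insertRS a T) := by
  induction T generalizing s with
  | nil => exact ⟨ha, trivial, trivial⟩
  | node z l r ihl ihr =>
    obtain ⟨hz, hl, hr⟩ := hT
    rw [_root_.insertRS]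
    split_ifs with h
    · exact ⟨hz, ihl hl ⟨ha, h⟩, hr⟩
    · exact ⟨hz, hl, ihr hr ⟨ha, lt_of_not_ge h⟩⟩

theorem isSearchTree_sylvTree (w : List A) : IsSearchTree Set.univ (sylvTree w) := by
  induction w with
  | nil => trivial
  | cons a w ih => exact ih.insertRS (Set.mem_univ a)

/-- The interval [z, z) is empty, so the root shows up as a final tick; this tells a nonempty tree
from the empty one. -/
theorem treeCounter_node_self (z : A) (l r : BinaryTree A) :
    treeCounter z z (.node z l r) = treeCounter z z l * tick := by
  simp [treeCounter, intervalCounter]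

/-- The pair (z, z') separates the trees: the smaller root gives a pure reset, the larger one a
final tick. -/
theorem not_treeCounter_eq_of_root_lt {s : Set A} {z z' : A} {l r l' r' : BinaryTree A}
    (hz : z ∈ s) (hz' : z' ∈ s) (h : ∀ y ∈ s, ∀ x ∈ s, y ≤ x →
      treeCounter y x (.node z l r) = treeCounter y x (.node z' l' r')) : ¬ z < z' := by
  intro hlt
  have := h z hz z' hz' hlt.le
  simp only [treeCounter, lt_irrefl, if_false, hlt, if_true, not_lt_of_gt hlt,
    intervalCounter] at this
  exact mul_tick_ne_clear _ this.symm

/-- A search tree is determined by its interval counters. -/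
theorem IsSearchTree.eq_of_treeCounter_eq {s : Set A} {T T' : BinaryTree A}
    (hT : IsSearchTree s T) (hT' : IsSearchTree s T')
    (h : ∀ y ∈ s, ∀ x ∈ s, y ≤ x → treeCounter y x T = treeCounter y x T') : T = T' := by
  induction T generalizing s T' with
  | nil =>
    cases T' with
    | nil => rfl
    | node z l r =>
      have := h z hT'.1 z hT'.1 le_rfl
      rw [treeCounter_node_self] at this
      exact absurd this.symm (mul_tick_ne_one _)
  | node z l r ihl ihr =>
    cases T' with
    | nil =>
      have := h z hT.1 z hT.1 le_rfl
      rw [treeCounter_node_self] at this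
      exact absurd this (mul_tick_ne_one _)
    | node z' l' r' =>
      obtain rfl : z = z' := le_antisymm
        (not_lt.1 (not_treeCounter_eq_of_root_lt hT'.1 hT.1
          fun y hy x hx hyx => (h y hy x hx hyx).symm))
        (not_lt.1 (not_treeCounter_eq_of_root_lt hT.1 hT'.1 h))
      congr 1
      · refine ihl hT.2.1 hT'.2.1 fun y hy x hx hyx => ?_
        have hyz : ¬ z < y := not_lt.2 hy.2
        have hxz : ¬ z < x := not_lt.2 hx.2
        have := h y hy.1 x hx.1 hyx
        simp only [treeCounter, hyz, hxz, if_false, intervalCounter, and_false] at this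
        -- The root contributes a tick or 1 on the right, and either can be cancelled to leave the
        -- left subtrees.
        split_ifs at this with hzx
        · exact mul_tick_right_cancel this
        · simpa using this
      · refine ihr hT.2.2 hT'.2.2 fun y hy x hx hyx => ?_
        have := h y hy.1 x hx.1 hyx
        simpa only [treeCounter, Set.mem_Ioi.1 hy.2, if_true] using this

theorem sylvTree_eq_iff (w₁ w₂ : FreeMonoid A) :
    sylvTree w₁.toList = sylvTree w₂.toList ↔ ∀ p : {p : A × A // p.1 ≤ p.2},
      FreeMonoid.lift (intervalCounter p.1.1 p.1.2) w₁ =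
        FreeMonoid.lift (intervalCounter p.1.1 p.1.2) w₂ := by
  constructor
  · intro h p
    rw [← treeCounter_sylvTree p.2, ← treeCounter_sylvTree p.2, h]
  · intro h
    refine (isSearchTree_sylvTree _).eq_of_treeCounter_eq (isSearchTree_sylvTree _)
      fun y _ x _ hyx => ?_
    rw [treeCounter_sylvTree hyx, treeCounter_sylvTree hyx]
    exact h ⟨(y, x), hyx⟩

theorem mirrorDual_insertLS (a : A) (T : BinaryTree A) :
    mirrorDual (insertLS a T) = insertRS (OrderDual.toDual a) (mirrorDual T) := by
  induction T with
  | nil => rfl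
  | node z l r ihl ihr =>
    by_cases h : z ≤ a <;> simp [insertLS, insertRS, mirrorDual, h, ihl, ihr]

/-- Reversing both the word and the order exchanges the two insertion procedures; word reversal is
what later becomes the passage to the opposite monoid. -/
theorem mirrorDual_sylvSharpTree (w : List A) :
    mirrorDual (sylvSharpTree w) = sylvTree (w.reverse.map OrderDual.toDual) := by
  induction w using List.reverseRecOn with
  | nil => rfl
  | append_singleton w a ih =>
    rw [sylvSharpTree_concat, mirrorDual_insertLS, ih]
    simp [sylvTree_cons]

theorem sylvSharpTree_eq_iff (w₁ w₂ : FreeMonoid A) :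
    sylvSharpTree w₁.toList = sylvSharpTree w₂.toList ↔ ∀ p : {p : Aᵒᵈ × Aᵒᵈ // p.1 ≤ p.2},
      FreeMonoid.lift (fun a => MulOpposite.op
          (intervalCounter p.1.1 p.1.2 (OrderDual.toDual a))) w₁ =
        FreeMonoid.lift (fun a => MulOpposite.op
          (intervalCounter p.1.1 p.1.2 (OrderDual.toDual a))) w₂ := by
  have e : ∀ (w : FreeMonoid A) (f : Aᵒᵈ → ResetCounter),
      (FreeMonoid.lift (fun a => MulOpposite.op (f (OrderDual.toDual a))) w).unop =
        FreeMonoid.lift f (FreeMonoid.map OrderDual.toDual w.reverse) := fun w f => by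
    rw [unop_lift_op (fun a => f (OrderDual.toDual a)), ← MonoidHom.comp_apply]
    exact DFunLike.congr_fun (FreeMonoid.hom_eq fun a => by simp) _
  rw [← mirrorDual_injective.eq_iff, mirrorDual_sylvSharpTree, mirrorDual_sylvSharpTree]
  refine (sylvTree_eq_iff (FreeMonoid.map OrderDual.toDual w₁.reverse)
    (FreeMonoid.map OrderDual.toDual w₂.reverse)).trans (forall_congr' fun p => ?_)
  rw [← e, ← e, MulOpposite.unop_inj]

end SylvesterTrees

/-! ### Varieties generated by the sylvester and #-sylvester monoids. -/

section Sylvester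

variable (A : Type) [LinearOrder A]

theorem generatedBy_sylvester_eq {a b : A} (hab : a < b) :
    MonoidVariety.generatedBy.{u, 0} (sylvesterCon A).Quotient =
      MonoidVariety.generatedBy.{u, 0} ResetCounter := by
  refine le_antisymm (MonoidVariety.generatedBy_le ?_) (MonoidVariety.generatedBy_le ?_)
  · exact MonoidVariety.mem_ulift_of_separating _ (MonoidVariety.mem_generatedBy ResetCounter)
      (fun p : {p : A × A // p.1 ≤ p.2} => FreeMonoid.lift (intervalCounter p.1.1 p.1.2))
      (sylvesterCon A).mk' Con.mk'_surjective
      fun w₁ w₂ h => (Con.eq _).2 ((sylvTree_eq_iff w₁ w₂).2 h)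
  -- The counter of the pair (a, b) sends a to the reset and b to the tick, so it maps the sylvester
  -- monoid onto the reset counter monoid.
  · refine MonoidVariety.mem_ulift_of_separating _
      (MonoidVariety.mem_generatedBy (sylvesterCon A).Quotient)
      (fun _ : Unit => (sylvesterCon A).mk') (FreeMonoid.lift (intervalCounter a b))
      (lift_surjective (x := a) (y := b) ?_ ?_)
      fun w₁ w₂ h => (sylvTree_eq_iff w₁ w₂).1 ((Con.eq _).1 (h ())) ⟨(a, b), hab.le⟩
    · simp [intervalCounter, hab, hab.ne]
    · simp [intervalCounter]

theorem generatedBy_sylvesterSharp_eq {a b : A} (hab : a < b) :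
    MonoidVariety.generatedBy.{u, 0} (sylvesterSharpCon A).Quotient =
      MonoidVariety.generatedBy.{u, 0} ResetCounterᵐᵒᵖ := by
  refine le_antisymm (MonoidVariety.generatedBy_le ?_) (MonoidVariety.generatedBy_le ?_)
  · exact MonoidVariety.mem_ulift_of_separating _
      (MonoidVariety.mem_generatedBy ResetCounterᵐᵒᵖ)
      (fun p : {p : Aᵒᵈ × Aᵒᵈ // p.1 ≤ p.2} => FreeMonoid.lift fun a =>
        MulOpposite.op (intervalCounter p.1.1 p.1.2 (OrderDual.toDual a)))
      (sylvesterSharpCon A).mk' Con.mk'_surjective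
      fun w₁ w₂ h => (Con.eq _).2 ((sylvSharpTree_eq_iff w₁ w₂).2 h)
  -- In the dual order the roles swap: b is the reset and a the tick.
  · have hba : OrderDual.toDual b < OrderDual.toDual a := hab
    refine MonoidVariety.mem_ulift_of_separating _
      (MonoidVariety.mem_generatedBy (sylvesterSharpCon A).Quotient)
      (fun _ : Unit => (sylvesterSharpCon A).mk')
      (FreeMonoid.lift fun c => MulOpposite.op
        (intervalCounter (OrderDual.toDual b) (OrderDual.toDual a) (OrderDual.toDual c)))
      (fun c => ?_)
      fun w₁ w₂ h => (sylvSharpTree_eq_iff w₁ w₂).1 ((Con.eq _).1 (h ())) ⟨(_, _), hba.le⟩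
    obtain ⟨w, hw⟩ := lift_surjective (x := b) (y := a) (f := fun c => intervalCounter
      (OrderDual.toDual b) (OrderDual.toDual a) (OrderDual.toDual c))
      (by simp [intervalCounter, hab, hab.ne']) (by simp [intervalCounter]) c.unop
    refine ⟨w.reverse, MulOpposite.unop_injective ?_⟩
    rw [unop_lift_op (fun c => intervalCounter (OrderDual.toDual b) (OrderDual.toDual a)
      (OrderDual.toDual c)), FreeMonoid.reverse_reverse, hw]

end Sylvester

theorem mainTheorem10 (n : ℕ) (hn : 2 ≤ n) :
    (MonoidVariety.generatedBy.{u, 0} (SylvRank n) < MonoidVariety.bicyclic.{u} ∧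
      (∀ (S : Type u) [CommSemiring S] (α : S), (Function.Injective fun k : ℕ => α ^ k) →
        Infinite (matrixM α) ∧
        MonoidVariety.generatedBy.{u, 0} (SylvRank n) =
          MonoidVariety.generatedBy.{u, u} (matrixM α)) ∧
      (∀ (F : Type u) [Monoid F] [Finite F],
        ¬ MonoidVariety.generatedBy.{u, 0} (SylvRank n) ≤
          MonoidVariety.comm.{u} ⊔ MonoidVariety.generatedBy.{u, u} F) ∧
      MonoidVariety.generatedBy.{u, 0} (SylvRank n) = MonoidVariety.generatedBy.{u, 0} Sylv) ∧
    (MonoidVariety.generatedBy.{u, 0} (SylvSharpRank n) < MonoidVariety.bicyclic.{u} ∧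
      (∀ (S : Type u) [CommSemiring S] (α : S), (Function.Injective fun k : ℕ => α ^ k) →
        Infinite (matrixMSharp α) ∧
        MonoidVariety.generatedBy.{u, 0} (SylvSharpRank n) =
          MonoidVariety.generatedBy.{u, u} (matrixMSharp α)) ∧
      (∀ (F : Type u) [Monoid F] [Finite F],
        ¬ MonoidVariety.generatedBy.{u, 0} (SylvSharpRank n) ≤
          MonoidVariety.comm.{u} ⊔ MonoidVariety.generatedBy.{u, u} F) ∧
      MonoidVariety.generatedBy.{u, 0} (SylvSharpRank n) =
        MonoidVariety.generatedBy.{u, 0} SylvSharp) := by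
  have h01 : (⟨0, by omega⟩ : Fin n) < ⟨1, by omega⟩ := by simp
  have h12 : (1 : ℕ+) < 2 := by decide
  -- Once both ranks are replaced by the reset counter monoid or its opposite, the equality of
  -- finite and infinite rank is `rfl`.
  rw [generatedBy_sylvester_eq (Fin n) h01, generatedBy_sylvester_eq ℕ+ h12,
    generatedBy_sylvesterSharp_eq (Fin n) h01, generatedBy_sylvesterSharp_eq ℕ+ h12]
  refine ⟨⟨resetCounter_lt_bicyclic, fun S _ α hα => ?_, ?_, rfl⟩,
    resetCounter_op_lt_bicyclic, fun S _ α hα => ?_, ?_, rfl⟩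
  · have e := (counterToMatrix α).equivOfMrangeEq (counterToMatrix_injective α hα)
      (mrange_counterToMatrix α)
    exact ⟨Infinite.of_injective _ e.injective, MonoidVariety.generatedBy_eq_of_mulEquiv e⟩
  · exact not_generatedBy_le_comm_sup_finite fun _ _ => resetCounter_pow_identity
  · have e := (counterOpToMatrix α).equivOfMrangeEq (counterOpToMatrix_injective α hα)
      (mrange_counterOpToMatrix α)
    exact ⟨Infinite.of_injective _ (e.injective.comp MulOpposite.op_injective),
      MonoidVariety.generatedBy_eq_of_mulEquiv e⟩
  · refine not_generatedBy_le_comm_sup_finite (x := MulOpposite.op tick)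
      (y := MulOpposite.op clear) fun i j h => ?_
    have := congrArg MulOpposite.unop h
    simp only [MulOpposite.unop_mul, MulOpposite.unop_pow, MulOpposite.unop_op,
      ← mul_assoc] at this
    exact (resetCounter_pow_identity this).symm
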